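/- Let $q\in\mathbb{C}\setminus\{0\}$ be not a root of unity ($q^n\neq 1$ for every non-zero integer $n$). Let $\mathbb{C}_q[x^{\pm1},y^{\pm1}]$ be the unital $\mathbb{C}$-algebra generated by $x,x^{-1},y,y^{-1}$ with relations $yx=qxy$, $xx^{-1}=x^{-1}x=yy^{-1}=y^{-1}y=1$. For $\sigma=\begin{pmatrix}k&l\\ m&n\end{pmatrix}\in SL(2,\mathbb{Z})$ and $\alpha,\beta\in\mathbb{C}\setminus\{0\}$ let $\varphi_{\sigma,\alpha,\beta}$ be the algebra automorphism of $\mathbb{C}_q[x^{\pm1},y^{\pm1}]$ determined by $\varphi_{\sigma,\alpha,\beta}(x)=\alpha x^ky^m$, $\varphi_{\sigma,\alpha,\beta}(y)=\beta x^ly^n$. Let $U_q(\mathfrak{sl}_2)$ be the Hopf algebra generated by $\mathsf{k},\mathsf{k}^{-1},\mathsf{e},\mathsf{f}$ with relations $$\mathsf{k}^{-1}\mathsf{k}=\mathsf{k}\mathsf{k}^{-1}=1,\quad \mathsf{ke}=q^2\mathsf{ek},\quad \mathsf{kf}=q^{-2}\mathsf{fk},\quad \mathsf{ef}-\mathsf{fe}=\frac{\mathsf{k}-\mathsf{k}^{-1}}{q-q^{-1}},$$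 comultiplication $\Delta(\mathsf{k})=\mathsf{k}\otimes\mathsf{k}$, $\Delta(\mathsf{e})=1\otimes\mathsf{e}+\mathsf{e}\otimes\mathsf{k}$, $\Delta(\mathsf{f})=\mathsf{f}\otimes1+\mathsf{k}^{-1}\otimes\mathsf{f}$, counit $\varepsilon(\mathsf{k})=1$, $\varepsilon(\mathsf{e})=\varepsilon(\mathsf{f})=0$, and antipode $S(\mathsf{k})=\mathsf{k}^{-1}$, $S(\mathsf{e})=-\mathsf{ek}^{-1}$, $S(\mathsf{f})=-\mathsf{kf}$. A $U_q(\mathfrak{sl}_2)$-symmetry on a unital $\mathbb{C}$-algebra $A$ is a homomorphism of algebras $\pi:U_q(\mathfrak{sl}_2)\to\operatorname{End}_{\mathbb{C}}A$ such that $\pi(h)(ab)=\sum_i\pi(h_i')(a)\,\pi(h_i'')(b)$ whenever $\Delta(h)=\sum_i h_i'\otimes h_i''$, and $\pi(h)(1)=\varepsilon(h)1$, for all $h\in U_q(\mathfrak{sl}_2)$ and $a,b\in A$. **Proposition.** Let $\sigma\in SL(2,\mathbb{Z})$ have eigenvalues $\lambda,\mu\in\mathbb{R}\setminus\{-1,1\}$,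 and let $\alpha,\beta\in\mathbb{C}\setminus\{0\}$. Then there exists no $U_q(\mathfrak{sl}_2)$-symmetry $\pi$ on $\mathbb{C}_q[x^{\pm1},y^{\pm1}]$ with $\pi(\mathsf{k})=\varphi_{\sigma,\alpha,\beta}$. -/

import Mathlib

open scoped TensorProduct MatrixGroups

/-! ## The quantum universal enveloping algebra of `sl₂` -/

/-- The Chevalley generators `k`, `k⁻¹`, `e`, `f`. -/
inductive UqGen : Type
  | k | kInv | e | f

/-- The defining relations of `U_q(sl₂)` inside the free algebra on the Chevalley generators. -/
inductive UqRel (q : ℂˣ) : FreeAlgebra ℂ UqGen → FreeAlgebra ℂ UqGen → Prop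
  | kInv_k : UqRel q (FreeAlgebra.ι ℂ UqGen.kInv * FreeAlgebra.ι ℂ UqGen.k) 1
  | k_kInv : UqRel q (FreeAlgebra.ι ℂ UqGen.k * FreeAlgebra.ι ℂ UqGen.kInv) 1
  | k_e : UqRel q (FreeAlgebra.ι ℂ UqGen.k * FreeAlgebra.ι ℂ UqGen.e)
      ((q : ℂ) ^ 2 • (FreeAlgebra.ι ℂ UqGen.e * FreeAlgebra.ι ℂ UqGen.k))
  | k_f : UqRel q (FreeAlgebra.ι ℂ UqGen.k * FreeAlgebra.ι ℂ UqGen.f)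
      (((q : ℂ) ^ 2)⁻¹ • (FreeAlgebra.ι ℂ UqGen.f * FreeAlgebra.ι ℂ UqGen.k))
  | e_f : UqRel q
      (FreeAlgebra.ι ℂ UqGen.e * FreeAlgebra.ι ℂ UqGen.f
        - FreeAlgebra.ι ℂ UqGen.f * FreeAlgebra.ι ℂ UqGen.e)
      (((q : ℂ) - (q : ℂ)⁻¹)⁻¹ • (FreeAlgebra.ι ℂ UqGen.k - FreeAlgebra.ι ℂ UqGen.kInv))

/-- The algebra `U_q(sl₂)` over `ℂ`, by generators and relations. -/
def Uq (q : ℂˣ) : Type := RingQuot (UqRel q)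

namespace Uq

noncomputable instance instRing (q : ℂˣ) : Ring (Uq q) :=
  inferInstanceAs (Ring (RingQuot (UqRel q)))

noncomputable instance instAlgebra (q : ℂˣ) : Algebra ℂ (Uq q) :=
  inferInstanceAs (Algebra ℂ (RingQuot (UqRel q)))

/-- The class of a Chevalley generator. -/
noncomputable def gen (q : ℂˣ) (g : UqGen) : Uq q :=
  RingQuot.mkAlgHom ℂ (UqRel q) (FreeAlgebra.ι ℂ g)

/-- The generator `k`. -/
noncomputable def k (q : ℂˣ) : Uq q := gen q UqGen.k
/-- The generator `k⁻¹`. -/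
noncomputable def kInv (q : ℂˣ) : Uq q := gen q UqGen.kInv
/-- The generator `e`. -/
noncomputable def e (q : ℂˣ) : Uq q := gen q UqGen.e
/-- The generator `f`. -/
noncomputable def f (q : ℂˣ) : Uq q := gen q UqGen.f

theorem kInv_mul_k (q : ℂˣ) : kInv q * k q = 1 := by
  have h := RingQuot.mkAlgHom_rel ℂ (UqRel.kInv_k (q := q))
  rw [map_mul, map_one] at h
  exact h

theorem k_mul_kInv (q : ℂˣ) : k q * kInv q = 1 := by
  have h := RingQuot.mkAlgHom_rel ℂ (UqRel.k_kInv (q := q))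
  rw [map_mul, map_one] at h
  exact h

theorem k_mul_e (q : ℂˣ) : k q * e q = (q : ℂ) ^ 2 • (e q * k q) := by
  have h := RingQuot.mkAlgHom_rel ℂ (UqRel.k_e (q := q))
  rw [map_smul, map_mul, map_mul] at h
  exact h

theorem k_mul_f (q : ℂˣ) : k q * f q = ((q : ℂ) ^ 2)⁻¹ • (f q * k q) := by
  have h := RingQuot.mkAlgHom_rel ℂ (UqRel.k_f (q := q))
  rw [map_smul, map_mul, map_mul] at h
  exact h

theorem e_f_sub (q : ℂˣ) :
    e q * f q - f q * e q = ((q : ℂ) - (q : ℂ)⁻¹)⁻¹ • (k q - kInv q) := by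
  have h := RingQuot.mkAlgHom_rel ℂ (UqRel.e_f (q := q))
  rw [map_smul, map_sub, map_sub, map_mul, map_mul] at h
  exact h

/-- The universal property of `U_q(sl₂)`. -/
noncomputable def lift (q : ℂˣ) {B : Type*} [Ring B] [Algebra ℂ B] (K K' E F : B)
    (h₁ : K' * K = 1) (h₂ : K * K' = 1) (h₃ : K * E = (q : ℂ) ^ 2 • (E * K))
    (h₄ : K * F = ((q : ℂ) ^ 2)⁻¹ • (F * K))
    (h₅ : E * F - F * E = ((q : ℂ) - (q : ℂ)⁻¹)⁻¹ • (K - K')) : Uq q →ₐ[ℂ] B :=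
  RingQuot.liftAlgHom ℂ ⟨FreeAlgebra.lift ℂ fun g => match g with
    | .k => K
    | .kInv => K'
    | .e => E
    | .f => F, by
      intro x y h
      cases h <;> simp only [map_mul, map_sub, map_smul, map_one, FreeAlgebra.lift_ι_apply] <;>
        assumption⟩

section
variable (q : ℂˣ) {B : Type*} [Ring B] [Algebra ℂ B] (K K' E F : B)
    (h₁ : K' * K = 1) (h₂ : K * K' = 1) (h₃ : K * E = (q : ℂ) ^ 2 • (E * K))
    (h₄ : K * F = ((q : ℂ) ^ 2)⁻¹ • (F * K))
    (h₅ : E * F - F * E = ((q : ℂ) - (q : ℂ)⁻¹)⁻¹ • (K - K'))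

@[simp] theorem lift_k : lift q K K' E F h₁ h₂ h₃ h₄ h₅ (k q) = K := by
  refine (RingQuot.liftAlgHom_mkAlgHom_apply ℂ _ _ _).trans ?_
  rw [FreeAlgebra.lift_ι_apply]

@[simp] theorem lift_kInv : lift q K K' E F h₁ h₂ h₃ h₄ h₅ (kInv q) = K' := by
  refine (RingQuot.liftAlgHom_mkAlgHom_apply ℂ _ _ _).trans ?_
  rw [FreeAlgebra.lift_ι_apply]

@[simp] theorem lift_e : lift q K K' E F h₁ h₂ h₃ h₄ h₅ (e q) = E := by
  refine (RingQuot.liftAlgHom_mkAlgHom_apply ℂ _ _ _).trans ?_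
  rw [FreeAlgebra.lift_ι_apply]

@[simp] theorem lift_f : lift q K K' E F h₁ h₂ h₃ h₄ h₅ (f q) = F := by
  refine (RingQuot.liftAlgHom_mkAlgHom_apply ℂ _ _ _).trans ?_
  rw [FreeAlgebra.lift_ι_apply]

end

theorem algHom_ext {q : ℂˣ} {B : Type*} [Semiring B] [Algebra ℂ B] {φ ψ : Uq q →ₐ[ℂ] B}
    (hk : φ (k q) = ψ (k q)) (hk' : φ (kInv q) = ψ (kInv q))
    (he : φ (e q) = ψ (e q)) (hf : φ (f q) = ψ (f q)) : φ = ψ := by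
  refine RingQuot.ringQuot_ext' ℂ φ ψ (FreeAlgebra.hom_ext (funext fun g => ?_))
  cases g <;> assumption

theorem induction {q : ℂˣ} {P : Uq q → Prop} (hk : P (k q)) (hk' : P (kInv q)) (he : P (e q))
    (hf : P (f q)) (hc : ∀ c : ℂ, P (algebraMap ℂ (Uq q) c))
    (hadd : ∀ a b, P a → P b → P (a + b)) (hmul : ∀ a b, P a → P b → P (a * b)) (a : Uq q) :
    P a := by
  obtain ⟨a, rfl⟩ := RingQuot.mkAlgHom_surjective ℂ (UqRel q) a
  induction a using FreeAlgebra.induction with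
  | grade0 r => rw [AlgHom.commutes]; exact hc r
  | grade1 g => cases g <;> assumption
  | mul a b ha hb => rw [map_mul]; exact hmul _ _ ha hb
  | add a b ha hb => rw [map_add]; exact hadd _ _ ha hb

theorem kInv_mul_e (q : ℂˣ) : kInv q * e q = ((q : ℂ) ^ 2)⁻¹ • (e q * kInv q) := by
  have hq : (q : ℂ) ^ 2 ≠ 0 := pow_ne_zero _ q.ne_zero
  calc kInv q * e q = ((q : ℂ) ^ 2)⁻¹ • (kInv q * ((q : ℂ) ^ 2 • (e q * k q)) * kInv q) := by
        rw [mul_smul_comm, smul_mul_assoc, inv_smul_smul₀ hq, mul_assoc, mul_assoc, k_mul_kInv,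
          mul_one]
    _ = ((q : ℂ) ^ 2)⁻¹ • (e q * kInv q) := by
        rw [← k_mul_e, ← mul_assoc (kInv q), kInv_mul_k, one_mul]

theorem f_mul_k (q : ℂˣ) : f q * k q = (q : ℂ) ^ 2 • (k q * f q) := by
  have hq : (q : ℂ) ^ 2 ≠ 0 := pow_ne_zero _ q.ne_zero
  rw [k_mul_f, smul_inv_smul₀ hq]

theorem kInv_mul_f (q : ℂˣ) : kInv q * f q = (q : ℂ) ^ 2 • (f q * kInv q) := by
  calc kInv q * f q = kInv q * (f q * k q) * kInv q := by
        rw [mul_assoc, mul_assoc, k_mul_kInv, mul_one]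
    _ = (q : ℂ) ^ 2 • (f q * kInv q) := by
        rw [f_mul_k, mul_smul_comm, smul_mul_assoc, ← mul_assoc (kInv q), kInv_mul_k, one_mul]

/-- The comultiplication: `Δ(k) = k ⊗ k`, `Δ(e) = 1 ⊗ e + e ⊗ k`, `Δ(f) = f ⊗ 1 + k⁻¹ ⊗ f`. -/
noncomputable def comulHom (q : ℂˣ) : Uq q →ₐ[ℂ] Uq q ⊗[ℂ] Uq q :=
  lift q (k q ⊗ₜ k q) (kInv q ⊗ₜ kInv q) (1 ⊗ₜ e q + e q ⊗ₜ k q) (f q ⊗ₜ 1 + kInv q ⊗ₜ f q)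
    (by rw [Algebra.TensorProduct.tmul_mul_tmul, kInv_mul_k, Algebra.TensorProduct.one_def])
    (by rw [Algebra.TensorProduct.tmul_mul_tmul, k_mul_kInv, Algebra.TensorProduct.one_def])
    (by
      simp only [mul_add, add_mul, Algebra.TensorProduct.tmul_mul_tmul, k_mul_e, mul_one, one_mul,
        smul_add, TensorProduct.tmul_smul, TensorProduct.smul_tmul'])
    (by
      simp only [mul_add, add_mul, Algebra.TensorProduct.tmul_mul_tmul, k_mul_f, mul_one, one_mul,
        smul_add, TensorProduct.tmul_smul, TensorProduct.smul_tmul', k_mul_kInv, kInv_mul_k])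
    (by
      have hq : (q : ℂ) ^ 2 ≠ 0 := pow_ne_zero _ q.ne_zero
      have h : (e q * kInv q) ⊗ₜ[ℂ] (k q * f q) = (kInv q * e q) ⊗ₜ[ℂ] (f q * k q) := by
        rw [kInv_mul_e, f_mul_k, TensorProduct.smul_tmul, inv_smul_smul₀ hq]
      have h1 : e q * f q = f q * e q + ((q : ℂ) - (q : ℂ)⁻¹)⁻¹ • (k q - kInv q) := by
        rw [← e_f_sub]; abel
      simp only [mul_add, add_mul, Algebra.TensorProduct.tmul_mul_tmul, mul_one, one_mul, h, h1,
        TensorProduct.add_tmul, TensorProduct.tmul_add, TensorProduct.tmul_smul,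
        ← TensorProduct.smul_tmul', smul_sub, TensorProduct.tmul_sub, TensorProduct.sub_tmul]
      abel)

/-- The counit: `ε(k) = 1`, `ε(e) = ε(f) = 0`. -/
noncomputable def counitHom (q : ℂˣ) : Uq q →ₐ[ℂ] ℂ :=
  lift q 1 1 0 0 (by simp) (by simp) (by simp) (by simp) (by simp)

/-- The antipode, as an algebra homomorphism to the opposite algebra:
`S(k) = k⁻¹`, `S(e) = -e k⁻¹`, `S(f) = -k f`. -/
noncomputable def antipodeHom (q : ℂˣ) : Uq q →ₐ[ℂ] (Uq q)ᵐᵒᵖ :=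
  lift q (MulOpposite.op (kInv q)) (MulOpposite.op (k q)) (MulOpposite.op (-(e q * kInv q)))
    (MulOpposite.op (-(k q * f q)))
    (by rw [← MulOpposite.op_mul, kInv_mul_k, MulOpposite.op_one])
    (by rw [← MulOpposite.op_mul, k_mul_kInv, MulOpposite.op_one])
    (by
      have hq : (q : ℂ) ^ 2 ≠ 0 := pow_ne_zero _ q.ne_zero
      rw [← MulOpposite.op_mul, ← MulOpposite.op_mul, ← MulOpposite.op_smul, mul_neg,
        ← mul_assoc, kInv_mul_e, smul_mul_assoc, smul_neg, smul_inv_smul₀ hq, neg_mul])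
    (by
      rw [← MulOpposite.op_mul, ← MulOpposite.op_mul, ← MulOpposite.op_smul, mul_neg, neg_mul,
        ← mul_assoc, kInv_mul_k, one_mul, k_mul_f, smul_mul_assoc, mul_assoc, k_mul_kInv, mul_one,
        smul_neg])
    (by
      have hq : (q : ℂ) ^ 2 ≠ 0 := pow_ne_zero _ q.ne_zero
      have h1 : k q * f q * (e q * kInv q) = f q * e q := by
        rw [k_mul_f, smul_mul_assoc, mul_assoc, ← mul_assoc (k q), k_mul_e, smul_mul_assoc,
          mul_smul_comm, inv_smul_smul₀ hq, mul_assoc, k_mul_kInv, mul_one]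
      have h2 : e q * kInv q * (k q * f q) = e q * f q := by
        rw [mul_assoc, ← mul_assoc (kInv q), kInv_mul_k, one_mul]
      rw [← MulOpposite.op_mul, ← MulOpposite.op_mul, ← MulOpposite.op_sub, ← MulOpposite.op_sub,
        ← MulOpposite.op_smul, neg_mul_neg, neg_mul_neg, h1, h2, ← neg_sub (e q * f q), e_f_sub,
        ← smul_neg, neg_sub])

noncomputable instance instBialgebra (q : ℂˣ) : Bialgebra ℂ (Uq q) :=
  Bialgebra.ofAlgHom (comulHom q) (counitHom q)
    (by
      apply algHom_ext <;>
        simp [comulHom, TensorProduct.add_tmul, TensorProduct.tmul_add,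
          Algebra.TensorProduct.one_def, add_assoc])
    (by apply algHom_ext <;> simp [comulHom, counitHom])
    (by apply algHom_ext <;> simp [comulHom, counitHom])

theorem comul_eq (q : ℂˣ) (a : Uq q) : Coalgebra.comul (R := ℂ) a = comulHom q a := rfl

theorem counit_eq (q : ℂˣ) (a : Uq q) : Coalgebra.counit (R := ℂ) a = counitHom q a := rfl

/-- The antipode as a linear map. -/
noncomputable def antipodeLin (q : ℂˣ) : Uq q →ₗ[ℂ] Uq q :=
  (MulOpposite.opLinearEquiv ℂ).symm.toLinearMap ∘ₗ (antipodeHom q).toLinearMap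

theorem antipodeLin_mul (q : ℂˣ) (a b : Uq q) :
    antipodeLin q (a * b) = antipodeLin q b * antipodeLin q a := by
  simp [antipodeLin]

theorem antipodeLin_algebraMap (q : ℂˣ) (c : ℂ) :
    antipodeLin q (algebraMap ℂ (Uq q) c) = algebraMap ℂ (Uq q) c := by
  simp [antipodeLin]

theorem antipodeLin_k (q : ℂˣ) : antipodeLin q (k q) = kInv q := by
  simp [antipodeLin, antipodeHom]

theorem antipodeLin_kInv (q : ℂˣ) : antipodeLin q (kInv q) = k q := by
  simp [antipodeLin, antipodeHom]

theorem antipodeLin_e (q : ℂˣ) : antipodeLin q (e q) = -(e q * kInv q) := by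
  simp [antipodeLin, antipodeHom]

theorem antipodeLin_f (q : ℂˣ) : antipodeLin q (f q) = -(k q * f q) := by
  simp [antipodeLin, antipodeHom]

theorem antipodeLin_one (q : ℂˣ) : antipodeLin q 1 = 1 := by
  simp [antipodeLin]

theorem mul_antipode_left (q : ℂˣ) (u : Uq q ⊗[ℂ] Uq q) (v : Uq q ⊗[ℂ] Uq q) (c : ℂ)
    (hu : LinearMap.mul' ℂ (Uq q) ((antipodeLin q).rTensor (Uq q) u) = algebraMap ℂ (Uq q) c) :
    LinearMap.mul' ℂ (Uq q) ((antipodeLin q).rTensor (Uq q) (u * v))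
      = c • LinearMap.mul' ℂ (Uq q) ((antipodeLin q).rTensor (Uq q) v) := by
  induction v using TensorProduct.induction_on with
  | zero => simp
  | add x y hx hy => rw [mul_add, map_add, map_add, hx, hy, map_add, map_add, smul_add]
  | tmul a b =>
    have h : LinearMap.mul' ℂ (Uq q) ((antipodeLin q).rTensor (Uq q) (u * a ⊗ₜ b))
        = antipodeLin q a * LinearMap.mul' ℂ (Uq q) ((antipodeLin q).rTensor (Uq q) u) * b := by
      clear hu
      induction u using TensorProduct.induction_on with
      | zero => simp
      | add x y hx hy => rw [add_mul, map_add, map_add, hx, hy, map_add, map_add, mul_add, add_mul]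
      | tmul x y => simp [antipodeLin_mul, mul_assoc]
    rw [h, hu, ← Algebra.commutes, mul_assoc, ← Algebra.smul_def]
    simp

theorem mul_antipode_right (q : ℂˣ) (u : Uq q ⊗[ℂ] Uq q) (v : Uq q ⊗[ℂ] Uq q) (c : ℂ)
    (hv : LinearMap.mul' ℂ (Uq q) ((antipodeLin q).lTensor (Uq q) v) = algebraMap ℂ (Uq q) c) :
    LinearMap.mul' ℂ (Uq q) ((antipodeLin q).lTensor (Uq q) (u * v))
      = c • LinearMap.mul' ℂ (Uq q) ((antipodeLin q).lTensor (Uq q) u) := by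
  induction u using TensorProduct.induction_on with
  | zero => simp
  | add x y hx hy => rw [add_mul, map_add, map_add, hx, hy, map_add, map_add, smul_add]
  | tmul a b =>
    have h : LinearMap.mul' ℂ (Uq q) ((antipodeLin q).lTensor (Uq q) (a ⊗ₜ b * v))
        = a * LinearMap.mul' ℂ (Uq q) ((antipodeLin q).lTensor (Uq q) v) * antipodeLin q b := by
      clear hv
      induction v using TensorProduct.induction_on with
      | zero => simp
      | add x y hx hy => rw [mul_add, map_add, map_add, hx, hy, map_add, map_add, mul_add, add_mul]
      | tmul x y => simp [antipodeLin_mul, mul_assoc]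
    rw [h, hv, ← Algebra.commutes, mul_assoc, ← Algebra.smul_def]
    simp

noncomputable instance instHopfAlgebra (q : ℂˣ) : HopfAlgebra ℂ (Uq q) where
  antipode := antipodeLin q
  mul_antipode_rTensor_comul := by
    ext a
    simp only [LinearMap.comp_apply, comul_eq, counit_eq, Algebra.linearMap_apply]
    induction a using Uq.induction with
    | hk => simp [comulHom, counitHom, antipodeLin_k, kInv_mul_k]
    | hk' => simp [comulHom, counitHom, antipodeLin_kInv, k_mul_kInv]
    | he =>
      simp [comulHom, counitHom, antipodeLin_e, antipodeLin_one, mul_assoc, kInv_mul_k]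
    | hf => simp [comulHom, counitHom, antipodeLin_f, antipodeLin_kInv]
    | hc c => simp [Algebra.TensorProduct.algebraMap_apply, antipodeLin_algebraMap]
    | hadd a b ha hb => simp only [map_add, ha, hb]
    | hmul a b ha hb =>
      rw [map_mul, mul_antipode_left q _ _ _ ha, hb, map_mul, map_mul, Algebra.smul_def]
  mul_antipode_lTensor_comul := by
    ext a
    simp only [LinearMap.comp_apply, comul_eq, counit_eq, Algebra.linearMap_apply]
    induction a using Uq.induction with
    | hk => simp [comulHom, counitHom, antipodeLin_k, k_mul_kInv]
    | hk' => simp [comulHom, counitHom, antipodeLin_kInv, kInv_mul_k]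
    | he => simp [comulHom, counitHom, antipodeLin_e, antipodeLin_k]
    | hf =>
      simp [comulHom, counitHom, antipodeLin_f, antipodeLin_one, ← mul_assoc, kInv_mul_k]
    | hc c => simp [Algebra.TensorProduct.algebraMap_apply, antipodeLin_one]
    | hadd a b ha hb => simp only [map_add, ha, hb]
    | hmul a b ha hb =>
      rw [map_mul, mul_antipode_right q _ _ _ hb, ha, map_mul, map_mul, Algebra.smul_def,
        Algebra.commutes]

end Uq

/-! ## Module algebras -/

/-- `π : H → End_ℂ A` is a structure of `H`-module algebra on `A`:
`π(h)(ab) = ∑ π(h')(a) π(h'')(b)` where `Δ(h) = ∑ h' ⊗ h''`, and `π(h)(1) = ε(h) 1`. -/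
structure IsModuleAlgebra {H A : Type*} [Ring H] [HopfAlgebra ℂ H] [Ring A] [Algebra ℂ A]
    (π : H →ₐ[ℂ] Module.End ℂ A) : Prop where
  map_mul : ∀ (h : H) (a b : A), π h (a * b) =
    LinearMap.mul' ℂ A (TensorProduct.map (LinearMap.applyₗ a ∘ₗ π.toLinearMap)
      (LinearMap.applyₗ b ∘ₗ π.toLinearMap) (Coalgebra.comul (R := ℂ) h))
  map_one : ∀ h : H, π h 1 = Coalgebra.counit (R := ℂ) h • (1 : A)

/-! ## Laurent polynomials over the quantum plane -/

/-- The generators `x`, `x⁻¹`, `y`, `y⁻¹`. -/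
inductive QTorusGen : Type
  | x | xInv | y | yInv

/-- The relations `yx = qxy`, `x x⁻¹ = x⁻¹ x = y y⁻¹ = y⁻¹ y = 1`. -/
inductive QTorusRel (q : ℂˣ) : FreeAlgebra ℂ QTorusGen → FreeAlgebra ℂ QTorusGen → Prop
  | y_x : QTorusRel q (FreeAlgebra.ι ℂ QTorusGen.y * FreeAlgebra.ι ℂ QTorusGen.x)
      ((q : ℂ) • (FreeAlgebra.ι ℂ QTorusGen.x * FreeAlgebra.ι ℂ QTorusGen.y))
  | x_xInv : QTorusRel q (FreeAlgebra.ι ℂ QTorusGen.x * FreeAlgebra.ι ℂ QTorusGen.xInv) 1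
  | xInv_x : QTorusRel q (FreeAlgebra.ι ℂ QTorusGen.xInv * FreeAlgebra.ι ℂ QTorusGen.x) 1
  | y_yInv : QTorusRel q (FreeAlgebra.ι ℂ QTorusGen.y * FreeAlgebra.ι ℂ QTorusGen.yInv) 1
  | yInv_y : QTorusRel q (FreeAlgebra.ι ℂ QTorusGen.yInv * FreeAlgebra.ι ℂ QTorusGen.y) 1

/-- The algebra `ℂ_q[x^{±1}, y^{±1}]`, by generators and relations. -/
def QTorus (q : ℂˣ) : Type := RingQuot (QTorusRel q)

namespace QTorus

noncomputable instance instRing (q : ℂˣ) : Ring (QTorus q) :=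
  inferInstanceAs (Ring (RingQuot (QTorusRel q)))

noncomputable instance instAlgebra (q : ℂˣ) : Algebra ℂ (QTorus q) :=
  inferInstanceAs (Algebra ℂ (RingQuot (QTorusRel q)))

/-- The class of a generator. -/
noncomputable def gen (q : ℂˣ) (g : QTorusGen) : QTorus q :=
  RingQuot.mkAlgHom ℂ (QTorusRel q) (FreeAlgebra.ι ℂ g)

/-- The generator `x`, as a unit with inverse the generator `x⁻¹`. -/
noncomputable def x (q : ℂˣ) : (QTorus q)ˣ where
  val := gen q QTorusGen.x
  inv := gen q QTorusGen.xInv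
  val_inv := by
    have h := RingQuot.mkAlgHom_rel ℂ (QTorusRel.x_xInv (q := q))
    rw [map_mul, map_one] at h
    exact h
  inv_val := by
    have h := RingQuot.mkAlgHom_rel ℂ (QTorusRel.xInv_x (q := q))
    rw [map_mul, map_one] at h
    exact h

/-- The generator `y`, as a unit with inverse the generator `y⁻¹`. -/
noncomputable def y (q : ℂˣ) : (QTorus q)ˣ where
  val := gen q QTorusGen.y
  inv := gen q QTorusGen.yInv
  val_inv := by
    have h := RingQuot.mkAlgHom_rel ℂ (QTorusRel.y_yInv (q := q))
    rw [map_mul, map_one] at h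
    exact h
  inv_val := by
    have h := RingQuot.mkAlgHom_rel ℂ (QTorusRel.yInv_y (q := q))
    rw [map_mul, map_one] at h
    exact h

/-- A non-zero scalar, as a unit of the algebra. -/
noncomputable def scalar (q : ℂˣ) : ℂˣ →* (QTorus q)ˣ :=
  Units.map (algebraMap ℂ (QTorus q)).toMonoidHom

theorem scalar_comm (q c : ℂˣ) (u : (QTorus q)ˣ) : Commute (scalar q c) u := by
  ext
  exact Algebra.commutes _ _

theorem y_mul_x (q : ℂˣ) : y q * x q = scalar q q * (x q * y q) := by
  have h := RingQuot.mkAlgHom_rel ℂ (QTorusRel.y_x (q := q))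
  rw [map_smul, map_mul, map_mul, Algebra.smul_def] at h
  ext
  exact h

/-- The universal property of `ℂ_q[x^{±1}, y^{±1}]`. -/
noncomputable def lift (q : ℂˣ) {B : Type*} [Ring B] [Algebra ℂ B] (X Y : Bˣ)
    (h : (Y : B) * X = (q : ℂ) • ((X : B) * Y)) : QTorus q →ₐ[ℂ] B :=
  RingQuot.liftAlgHom ℂ ⟨FreeAlgebra.lift ℂ fun g => match g with
    | .x => (X : B)
    | .xInv => ((X⁻¹ : Bˣ) : B)
    | .y => (Y : B)
    | .yInv => ((Y⁻¹ : Bˣ) : B), by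
      intro a b r
      cases r <;> simp only [map_mul, map_smul, map_one, FreeAlgebra.lift_ι_apply,
        Units.mul_inv, Units.inv_mul]
      assumption⟩

@[simp] theorem lift_x (q : ℂˣ) {B : Type*} [Ring B] [Algebra ℂ B] (X Y : Bˣ)
    (h : (Y : B) * X = (q : ℂ) • ((X : B) * Y)) : lift q X Y h (x q) = X := by
  refine (RingQuot.liftAlgHom_mkAlgHom_apply ℂ _ _ _).trans ?_
  rw [FreeAlgebra.lift_ι_apply]

@[simp] theorem lift_y (q : ℂˣ) {B : Type*} [Ring B] [Algebra ℂ B] (X Y : Bˣ)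
    (h : (Y : B) * X = (q : ℂ) • ((X : B) * Y)) : lift q X Y h (y q) = Y := by
  refine (RingQuot.liftAlgHom_mkAlgHom_apply ℂ _ _ _).trans ?_
  rw [FreeAlgebra.lift_ι_apply]

theorem algHom_ext {q : ℂˣ} {B : Type*} [Ring B] [Algebra ℂ B] {φ ψ : QTorus q →ₐ[ℂ] B}
    (hx : φ (x q) = ψ (x q)) (hy : φ (y q) = ψ (y q)) : φ = ψ := by
  have hx' : Units.map (φ : QTorus q →* B) (x q) = Units.map (ψ : QTorus q →* B) (x q) :=
    Units.ext hx
  have hy' : Units.map (φ : QTorus q →* B) (y q) = Units.map (ψ : QTorus q →* B) (y q) :=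
    Units.ext hy
  refine RingQuot.ringQuot_ext' ℂ φ ψ (FreeAlgebra.hom_ext (funext fun g => ?_))
  cases g
  · exact hx
  · exact congrArg (fun u : Bˣ => ((u⁻¹ : Bˣ) : B)) hx'
  · exact hy
  · exact congrArg (fun u : Bˣ => ((u⁻¹ : Bˣ) : B)) hy'

/-- The unit `c xⁱ yʲ`. -/
noncomputable def mono (q c : ℂˣ) (i j : ℤ) : (QTorus q)ˣ := scalar q c * (x q ^ i * y q ^ j)

theorem y_zpow_mul_x_zpow (q : ℂˣ) (i j : ℤ) :
    y q ^ j * x q ^ i = scalar q (q ^ (i * j)) * (x q ^ i * y q ^ j) := by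
  have h1 : SemiconjBy (y q) (x q) (scalar q q * x q) := by
    rw [SemiconjBy, y_mul_x, mul_assoc]
  have h2 : SemiconjBy (y q) (x q ^ i) (scalar q (q ^ i) * x q ^ i) := by
    have h := h1.zpow_right i
    rwa [(scalar_comm q q (x q)).mul_zpow, ← map_zpow] at h
  have h3 : SemiconjBy ((x q ^ i)⁻¹) (y q) (scalar q (q ^ i) * y q) := by
    have h : y q * x q ^ i = scalar q (q ^ i) * x q ^ i * y q := h2
    rw [SemiconjBy, inv_mul_eq_iff_eq_mul, ← mul_assoc, ← mul_assoc,
      ← (scalar_comm q (q ^ i) (x q ^ i)).eq, ← h, mul_inv_cancel_right]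
  have h4 := h3.zpow_right j
  rw [(scalar_comm q _ (y q)).mul_zpow, ← map_zpow, ← zpow_mul, SemiconjBy,
    inv_mul_eq_iff_eq_mul, ← mul_assoc, ← mul_assoc, ← (scalar_comm q _ (x q ^ i)).eq,
    eq_mul_inv_iff_mul_eq, mul_assoc] at h4
  exact h4

theorem mono_mul (q c d : ℂˣ) (i j i' j' : ℤ) :
    mono q c i j * mono q d i' j' = mono q (c * d * q ^ (i' * j)) (i + i') (j + j') := by
  have h1 := (scalar_comm q d (x q ^ i * y q ^ j)).eq
  have h2 := (scalar_comm q (q ^ (i' * j)) (x q ^ i)).eq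
  calc mono q c i j * mono q d i' j'
      = scalar q c * (x q ^ i * y q ^ j * scalar q d) * (x q ^ i' * y q ^ j') := by
        simp only [mono, mul_assoc]
    _ = scalar q c * scalar q d * (x q ^ i * (y q ^ j * x q ^ i') * y q ^ j') := by
        rw [← h1]; simp only [mul_assoc]
    _ = scalar q c * scalar q d * (x q ^ i * scalar q (q ^ (i' * j)) * x q ^ i' * y q ^ j
          * y q ^ j') := by
        rw [y_zpow_mul_x_zpow]; simp only [mul_assoc]
    _ = _ := by
        rw [← h2]; simp only [mono, map_mul, zpow_add, mul_assoc]

theorem mono_one (q : ℂˣ) : mono q 1 0 0 = 1 := by simp [mono]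

theorem mono_inv (q c : ℂˣ) (i j : ℤ) : ∃ d, (mono q c i j)⁻¹ = mono q d (-i) (-j) := by
  refine ⟨c⁻¹ * q ^ (i * j), inv_eq_of_mul_eq_one_right ?_⟩
  rw [mono_mul, ← mono_one q]
  congr 1
  · rw [neg_mul, zpow_neg]; group
  · ring
  · ring

theorem mono_zpow (q c : ℂˣ) (i j n : ℤ) : ∃ d, mono q c i j ^ n = mono q d (n * i) (n * j) := by
  induction n with
  | zero => exact ⟨1, by simp [mono_one]⟩
  | succ n ih =>
    obtain ⟨d, hd⟩ := ih
    exact ⟨_, by rw [zpow_add_one, hd, mono_mul]; congr 1 <;> ring⟩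
  | pred n ih =>
    obtain ⟨d, hd⟩ := ih
    obtain ⟨d', hd'⟩ := mono_inv q c i j
    exact ⟨_, by rw [zpow_sub_one, hd, hd', mono_mul]; congr 1 <;> ring⟩

/-- The algebra endomorphism with `x ↦ α x^k y^m`, `y ↦ β x^l y^n`, where
`σ = !![k, l; m, n]`. -/
noncomputable def phiHom (q : ℂˣ) (σ : SL(2, ℤ)) (α β : ℂˣ) : QTorus q →ₐ[ℂ] QTorus q :=
  lift q (mono q α (σ 0 0) (σ 1 0)) (mono q β (σ 0 1) (σ 1 1)) (by
    have hdet : σ 0 0 * σ 1 1 = 1 + σ 0 1 * σ 1 0 := by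
      have h := σ.det_coe
      rw [Matrix.det_fin_two] at h
      linarith
    have h : mono q β (σ 0 1) (σ 1 1) * mono q α (σ 0 0) (σ 1 0)
        = scalar q q * (mono q α (σ 0 0) (σ 1 0) * mono q β (σ 0 1) (σ 1 1)) := by
      rw [mono_mul, mono_mul, hdet]
      simp only [mono, ← mul_assoc, ← map_mul]
      congr 2
      · rw [zpow_add, zpow_one]; congr 1; ac_rfl
      · rw [add_comm]
      · rw [add_comm]
    have h' := congrArg Units.val h
    rw [Algebra.smul_def]
    exact h')

theorem phiHom_x (q : ℂˣ) (σ : SL(2, ℤ)) (α β : ℂˣ) :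
    phiHom q σ α β (x q) = mono q α (σ 0 0) (σ 1 0) := lift_x q _ _ _

theorem phiHom_y (q : ℂˣ) (σ : SL(2, ℤ)) (α β : ℂˣ) :
    phiHom q σ α β (y q) = mono q β (σ 0 1) (σ 1 1) := lift_y q _ _ _

theorem phiHom_mono (q : ℂˣ) (σ : SL(2, ℤ)) (α β c : ℂˣ) (i j : ℤ) : ∃ d,
    phiHom q σ α β (mono q c i j) =
      mono q d (i * σ 0 0 + j * σ 0 1) (i * σ 1 0 + j * σ 1 1) := by
  let φ : (QTorus q)ˣ →* (QTorus q)ˣ := Units.map (phiHom q σ α β : QTorus q →* QTorus q)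
  have hx : φ (x q) = mono q α (σ 0 0) (σ 1 0) := Units.ext (phiHom_x q σ α β)
  have hy : φ (y q) = mono q β (σ 0 1) (σ 1 1) := Units.ext (phiHom_y q σ α β)
  have hc : φ (scalar q c) = mono q c 0 0 := by
    ext
    simp [φ, scalar, mono]
  obtain ⟨d, hd⟩ := mono_zpow q α (σ 0 0) (σ 1 0) i
  obtain ⟨d', hd'⟩ := mono_zpow q β (σ 0 1) (σ 1 1) j
  have h : φ (mono q c i j) = mono q c 0 0 * (mono q d (i * σ 0 0) (i * σ 1 0) *
      mono q d' (j * σ 0 1) (j * σ 1 1)) := by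
    rw [mono, map_mul, map_mul, map_zpow, map_zpow, hx, hy, hc, hd, hd']
  rw [mono_mul, mono_mul, zero_add, zero_add] at h
  exact ⟨_, congrArg Units.val h⟩

theorem phiHom_comp_bijective (q : ℂˣ) (σ τ : SL(2, ℤ)) (h : σ * τ = 1) (α β γ δ : ℂˣ) :
    Function.Bijective ((phiHom q σ α β).comp (phiHom q τ γ δ)) := by
  have e : ∀ i j, (σ * τ) i j = (1 : SL(2, ℤ)) i j := fun i j => by rw [h]
  have e00 : τ 0 0 * σ 0 0 + τ 1 0 * σ 0 1 = 1 := by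
    have := e 0 0; simp [Matrix.mul_apply, Fin.sum_univ_two] at this; linarith
  have e10 : τ 0 0 * σ 1 0 + τ 1 0 * σ 1 1 = 0 := by
    have := e 1 0; simp [Matrix.mul_apply, Fin.sum_univ_two] at this; linarith
  have e01 : τ 0 1 * σ 0 0 + τ 1 1 * σ 0 1 = 0 := by
    have := e 0 1; simp [Matrix.mul_apply, Fin.sum_univ_two] at this; linarith
  have e11 : τ 0 1 * σ 1 0 + τ 1 1 * σ 1 1 = 1 := by
    have := e 1 1; simp [Matrix.mul_apply, Fin.sum_univ_two] at this; linarith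
  have mx : ∀ c : ℂˣ, ((mono q c 1 0 : (QTorus q)ˣ) : QTorus q) = (c : ℂ) • (x q : QTorus q) := by
    intro c; simp [mono, scalar, Algebra.smul_def]
  have my : ∀ c : ℂˣ, ((mono q c 0 1 : (QTorus q)ˣ) : QTorus q) = (c : ℂ) • (y q : QTorus q) := by
    intro c; simp [mono, scalar, Algebra.smul_def]
  have px : ∀ c d : ℂˣ, phiHom q 1 c d (x q) = (c : ℂ) • (x q : QTorus q) := by
    intro c d; rw [phiHom_x]; simp [mx]
  have py : ∀ c d : ℂˣ, phiHom q 1 c d (y q) = (d : ℂ) • (y q : QTorus q) := by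
    intro c d; rw [phiHom_y]; simp [my]
  obtain ⟨a, ha⟩ := phiHom_mono q σ α β γ (τ 0 0) (τ 1 0)
  obtain ⟨b, hb⟩ := phiHom_mono q σ α β δ (τ 0 1) (τ 1 1)
  rw [e00, e10, mx] at ha
  rw [e01, e11, my] at hb
  have hφ : (phiHom q σ α β).comp (phiHom q τ γ δ) = phiHom q 1 a b := by
    apply algHom_ext
    · rw [AlgHom.comp_apply, phiHom_x, ha, px]
    · rw [AlgHom.comp_apply, phiHom_y, hb, py]
  have hinv : ∀ c d : ℂˣ, (phiHom q 1 c d).comp (phiHom q 1 c⁻¹ d⁻¹) = AlgHom.id ℂ _ := by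
    intro c d
    apply algHom_ext
    · rw [AlgHom.comp_apply, px, map_smul, px, smul_smul]; simp
    · rw [AlgHom.comp_apply, py, map_smul, py, smul_smul]; simp
  rw [hφ]
  refine Function.bijective_iff_has_inverse.2 ⟨phiHom q 1 a⁻¹ b⁻¹, fun z => ?_, fun z => ?_⟩
  · have h := hinv a⁻¹ b⁻¹
    rw [inv_inv, inv_inv] at h
    exact DFunLike.congr_fun h z
  · exact DFunLike.congr_fun (hinv a b) z

theorem phiHom_bijective (q : ℂˣ) (σ : SL(2, ℤ)) (α β : ℂˣ) :
    Function.Bijective (phiHom q σ α β) := by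
  constructor
  · refine Function.Injective.of_comp (f := phiHom q σ⁻¹ 1 1) ?_
    exact (phiHom_comp_bijective q σ⁻¹ σ (inv_mul_cancel σ) 1 1 α β).1
  · refine Function.Surjective.of_comp (g := phiHom q σ⁻¹ 1 1) ?_
    exact (phiHom_comp_bijective q σ σ⁻¹ (mul_inv_cancel σ) α β 1 1).2

/-- The automorphism `φ_{σ,α,β}`, determined by `x ↦ α x^k y^m`, `y ↦ β x^l y^n`, where
`σ = !![k, l; m, n]`. -/
noncomputable def phi (q : ℂˣ) (σ : SL(2, ℤ)) (α β : ℂˣ) : QTorus q ≃ₐ[ℂ] QTorus q :=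
  AlgEquiv.ofBijective (phiHom q σ α β) (phiHom_bijective q σ α β)

theorem phi_x (q : ℂˣ) (σ : SL(2, ℤ)) (α β : ℂˣ) :
    phi q σ α β (x q) = (α : ℂ) • (((x q ^ σ 0 0 : (QTorus q)ˣ) : QTorus q) *
      ((y q ^ σ 1 0 : (QTorus q)ˣ) : QTorus q)) := by
  rw [phi, AlgEquiv.ofBijective_apply, phiHom_x, mono, Algebra.smul_def]
  rfl

theorem phi_y (q : ℂˣ) (σ : SL(2, ℤ)) (α β : ℂˣ) :
    phi q σ α β (y q) = (β : ℂ) • (((x q ^ σ 0 1 : (QTorus q)ˣ) : QTorus q) *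
      ((y q ^ σ 1 1 : (QTorus q)ˣ) : QTorus q)) := by
  rw [phi, AlgEquiv.ofBijective_apply, phiHom_y, mono, Algebra.smul_def]
  rfl

end QTorus

/-! Write φ for the action of `k`. The action of `e` is a skew derivation D with D(ab) = a D(b) +
D(a) φ(b) and φD = q²Dφ. The main point is that D = 0 (`skewDerivation_eq_zero`). Then the relation
for ef - fe forces `k` and `k⁻¹` to act alike, so φ² = 1, and σ² fixes the degree (1, 0). This is
impossible, because a linear functional ℓ that is injective on ℤ² is scaled by r² ≠ 1 under σ².

For a monomial M of degree v put N = φ²(M) and D(M) = Mu, so that D(N) = q⁻⁴ N φ²(u). The monomials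
M and N commute up to a scalar. Applying D to that relation and cancelling MN gives q⁻⁴(φ²(u) - M⁻¹
φ²(u) φ(M)) = u - N⁻¹ u φ(N). The eigenvalue r is irrational, so a left r-eigenvector of σ gives ℓ
(`exists_degree_functional`), and ℓ orders the degrees. With the sign of ℓ chosen so that (r -
1)ℓ(v) > 0, both subtracted terms are strictly higher than the terms they accompany. Comparing
lowest terms (`eq_zero_of_smul_sub_eq_sub`) leaves only the constant term of u, and there q⁻⁴ ≠ 1
excludes it. Using φ² instead of φ makes the scaling factor r² positive, so the order is preserved
even when r < 0. -/

namespace QTorus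

/-! ### The monomial basis of the quantum torus. -/

/-- The translation `(X g)(i, j) = g(i - 1, j)` on functions on `ℤ × ℤ`. -/
def shiftX : (Module.End ℂ (ℤ × ℤ → ℂ))ˣ where
  val := { toFun := fun g p => g (p.1 - 1, p.2), map_add' := fun _ _ => rfl,
           map_smul' := fun _ _ => rfl }
  inv := { toFun := fun g p => g (p.1 + 1, p.2), map_add' := fun _ _ => rfl,
           map_smul' := fun _ _ => rfl }
  val_inv := by ext g p; simp
  inv_val := by ext g p; simp

/-- The twisted translation `(Y g)(i, j) = qⁱ g(i, j - 1)` on functions on `ℤ × ℤ`. -/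
noncomputable def shiftY (q : ℂˣ) : (Module.End ℂ (ℤ × ℤ → ℂ))ˣ where
  val := { toFun := fun g p => (q : ℂ) ^ p.1 * g (p.1, p.2 - 1),
           map_add' := fun _ _ => funext fun _ => mul_add _ _ _,
           map_smul' := fun _ _ => funext fun _ => mul_left_comm _ _ _ }
  inv := { toFun := fun g p => ((q : ℂ) ^ p.1)⁻¹ * g (p.1, p.2 + 1),
           map_add' := fun _ _ => funext fun _ => mul_add _ _ _,
           map_smul' := fun _ _ => funext fun _ => mul_left_comm _ _ _ }
  val_inv := by
    ext g p
    simp [mul_inv_cancel_left₀ (zpow_ne_zero _ q.ne_zero)]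
  inv_val := by
    ext g p
    simp [inv_mul_cancel_left₀ (zpow_ne_zero _ q.ne_zero)]

theorem shiftX_zpow_apply (n : ℤ) (g : ℤ × ℤ → ℂ) (p : ℤ × ℤ) :
    ((shiftX ^ n : (Module.End ℂ (ℤ × ℤ → ℂ))ˣ) : Module.End ℂ (ℤ × ℤ → ℂ)) g p
      = g (p.1 - n, p.2) := by
  induction n generalizing g with
  | zero => simp
  | succ n ih =>
    rw [zpow_add_one, Units.val_mul, Module.End.mul_apply, ih]
    change g (p.1 - n - 1, p.2) = _
    rw [sub_sub]
  | pred n ih =>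
    rw [zpow_sub_one, Units.val_mul, Module.End.mul_apply, ih]
    change g (p.1 - -n + 1, p.2) = _
    rw [sub_add]

theorem shiftY_zpow_apply (q : ℂˣ) (n : ℤ) (g : ℤ × ℤ → ℂ) (p : ℤ × ℤ) :
    ((shiftY q ^ n : (Module.End ℂ (ℤ × ℤ → ℂ))ˣ) : Module.End ℂ (ℤ × ℤ → ℂ)) g p
      = (q : ℂ) ^ (p.1 * n) * g (p.1, p.2 - n) := by
  induction n generalizing g with
  | zero => simp
  | succ n ih =>
    rw [zpow_add_one, Units.val_mul, Module.End.mul_apply, ih]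
    change _ * ((q : ℂ) ^ p.1 * g (p.1, p.2 - n - 1)) = _
    rw [sub_sub, mul_add, mul_one, zpow_add₀ q.ne_zero, mul_assoc]
  | pred n ih =>
    rw [zpow_sub_one, Units.val_mul, Module.End.mul_apply, ih]
    change _ * (((q : ℂ) ^ p.1)⁻¹ * g (p.1, p.2 - -n + 1)) = _
    rw [sub_add, mul_sub, mul_one, zpow_sub₀ q.ne_zero, div_eq_mul_inv, mul_assoc]

/-- The representation of the quantum torus by twisted translations. -/
noncomputable def shiftRep (q : ℂˣ) : QTorus q →ₐ[ℂ] Module.End ℂ (ℤ × ℤ → ℂ) :=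
  lift q shiftX (shiftY q) (by
    ext g p
    change (q : ℂ) ^ p.1 * g (p.1 - 1, p.2 - 1)
      = (q : ℂ) * ((q : ℂ) ^ (p.1 - 1) * g (p.1 - 1, p.2 - 1))
    rw [← mul_assoc, ← zpow_one_add₀ q.ne_zero, add_sub_cancel])

theorem shiftRep_mono_one (q : ℂˣ) (i j : ℤ) (g : ℤ × ℤ → ℂ) (p : ℤ × ℤ) :
    shiftRep q (mono q 1 i j) g p = (q : ℂ) ^ ((p.1 - i) * j) * g (p.1 - i, p.2 - j) := by
  let φ := Units.map (shiftRep q : QTorus q →* Module.End ℂ (ℤ × ℤ → ℂ))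
  have hx : φ (x q) = shiftX := Units.ext (lift_x q _ _ _)
  have hy : φ (y q) = shiftY q := Units.ext (lift_y q _ _ _)
  have h : φ (mono q 1 i j) = shiftX ^ i * shiftY q ^ j := by
    rw [mono, map_one, one_mul, map_mul, map_zpow, map_zpow, hx, hy]
  have h' : shiftRep q (mono q 1 i j) = _ := congrArg Units.val h
  rw [h', Units.val_mul, Module.End.mul_apply, shiftX_zpow_apply, shiftY_zpow_apply]

theorem coe_mono (q c : ℂˣ) (i j : ℤ) :
    (mono q c i j : QTorus q) = (c : ℂ) • (mono q 1 i j : QTorus q) := by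
  simp [mono, scalar, Algebra.smul_def]

/-- Under `shiftRep` the monomials move the delta function at the origin to delta functions at
distinct points, so evaluation at a point reads off one coefficient. -/
theorem linearIndependent_mono (q : ℂˣ) :
    LinearIndependent ℂ fun p : ℤ × ℤ => (mono q 1 p.1 p.2 : QTorus q) := by
  rw [linearIndependent_iff]
  intro c hc
  ext p
  -- Act on the delta function at the origin, then evaluate at `p`. On the support the power of q
  -- has exponent 0, so the value is exactly 1.
  let Φ : QTorus q →ₗ[ℂ] ℂ := LinearMap.proj p ∘ₗ
    LinearMap.applyₗ (Pi.single (0, 0) 1 : ℤ × ℤ → ℂ) ∘ₗ (shiftRep q).toLinearMap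
  have hΦ : ∀ r : ℤ × ℤ, Φ (mono q 1 r.1 r.2) = if r = p then 1 else 0 := by
    intro r
    have : Φ (mono q 1 r.1 r.2) = shiftRep q (mono q 1 r.1 r.2) (Pi.single (0, 0) 1) p := rfl
    rw [this, shiftRep_mono_one, Pi.single_apply]
    split_ifs with h1 h2 h2
    · subst h2; simp
    · exact absurd (Prod.ext (by have := congrArg Prod.fst h1; simp at this; linarith)
        (by have := congrArg Prod.snd h1; simp at this; linarith)) h2
    · subst h2; simp at h1
    · simp
  have h := congrArg Φ hc
  rw [Finsupp.linearCombination_apply, map_finsuppSum, map_zero] at h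
  simpa [hΦ, Finsupp.sum] using h

/-- The span is closed under products, since monomials multiply to scalar multiples of monomials,
and it contains the scalars and all four generators. -/
theorem span_mono (q : ℂˣ) :
    Submodule.span ℂ (Set.range fun p : ℤ × ℤ => (mono q 1 p.1 p.2 : QTorus q)) = ⊤ := by
  set S := Submodule.span ℂ (Set.range fun p : ℤ × ℤ => (mono q 1 p.1 p.2 : QTorus q)) with hS
  have hmem : ∀ c i j, (mono q c i j : QTorus q) ∈ S := fun c i j => by
    rw [coe_mono]
    exact S.smul_mem _ (Submodule.subset_span ⟨(i, j), rfl⟩)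
  have hmul : ∀ a ∈ S, ∀ b ∈ S, a * b ∈ S := by
    intro a ha b hb
    have h : S * S ≤ S := by
      rw [hS, Submodule.span_mul_span, Submodule.span_le]
      rintro _ ⟨_, ⟨p, rfl⟩, _, ⟨r, rfl⟩, rfl⟩
      have := hmem (1 * 1 * q ^ (r.1 * p.2)) (p.1 + r.1) (p.2 + r.2)
      rw [← mono_mul] at this
      exact this
    exact h (Submodule.mul_mem_mul ha hb)
  refine Submodule.eq_top_iff'.2 fun a => ?_
  obtain ⟨a, rfl⟩ := RingQuot.mkAlgHom_surjective ℂ (QTorusRel q) a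
  induction a using FreeAlgebra.induction with
  | grade0 r =>
    rw [AlgHom.commutes, Algebra.algebraMap_eq_smul_one]
    have := hmem 1 0 0
    rw [mono_one] at this
    exact S.smul_mem _ this
  | grade1 g =>
    cases g
    · have := hmem 1 1 0
      simp [mono] at this
      exact this
    · have := hmem 1 (-1) 0
      simp [mono] at this
      exact this
    · have := hmem 1 0 1
      simp [mono] at this
      exact this
    · have := hmem 1 0 (-1)
      simp [mono] at this
      exact this
  | mul a b ha hb => rw [map_mul]; exact hmul _ ha _ hb
  | add a b ha hb => rw [map_add]; exact S.add_mem ha hb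

/-- The basis of monomials `xⁱ yʲ`. -/
noncomputable def monoBasis (q : ℂˣ) : Module.Basis (ℤ × ℤ) ℂ (QTorus q) :=
  Module.Basis.mk (linearIndependent_mono q) (span_mono q).ge

theorem monoBasis_apply (q : ℂˣ) (p : ℤ × ℤ) : monoBasis q p = (mono q 1 p.1 p.2 : QTorus q) :=
  Module.Basis.mk_apply _ _ _

theorem monoBasis_repr_mono (q c : ℂˣ) (i j : ℤ) :
    (monoBasis q).repr (mono q c i j : QTorus q) = Finsupp.single (i, j) (c : ℂ) := by
  have h := (monoBasis q).repr_self (i, j)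
  rw [monoBasis_apply] at h
  rw [coe_mono, map_smul, h, Finsupp.smul_single, smul_eq_mul, mul_one]

/-! ### Linear maps that permute or shift degrees. -/

/-- `L` is a linear map sending each monomial of degree `p` to a non-zero multiple of a monomial
of degree `τ p`. -/
def IsMonomialMap {q : ℂˣ} (L : QTorus q →ₗ[ℂ] QTorus q) (τ : ℤ × ℤ → ℤ × ℤ) : Prop :=
  ∀ (c : ℂˣ) (p : ℤ × ℤ), ∃ d : ℂˣ,
    L (mono q c p.1 p.2) = (mono q d (τ p).1 (τ p).2 : QTorus q)

namespace IsMonomialMap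

variable {q : ℂˣ} {L L' : QTorus q →ₗ[ℂ] QTorus q} {τ τ' : ℤ × ℤ → ℤ × ℤ}

theorem comp (h : IsMonomialMap L τ) (h' : IsMonomialMap L' τ') :
    IsMonomialMap (L ∘ₗ L') (τ ∘ τ') := fun c p => by
  obtain ⟨d, hd⟩ := h' c p
  obtain ⟨d', hd'⟩ := h d (τ' p)
  exact ⟨d', by rw [LinearMap.comp_apply, hd, hd']; rfl⟩

/-- When `τ` is injective no two terms of `a` can collide, so the coefficient at `τ p` comes from
degree `p` alone. -/
theorem exists_repr_apply (h : IsMonomialMap L τ) (hτ : Function.Injective τ) (p : ℤ × ℤ) :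
    ∃ s : ℂ, s ≠ 0 ∧ ∀ a, (monoBasis q).repr (L a) (τ p) = s * (monoBasis q).repr a p := by
  obtain ⟨d, hd⟩ := h 1 p
  refine ⟨d, d.ne_zero, fun a => ?_⟩
  have key : (monoBasis q).coord (τ p) ∘ₗ L = (d : ℂ) • (monoBasis q).coord p := by
    refine (monoBasis q).ext fun r => ?_
    obtain ⟨d', hd'⟩ := h 1 r
    simp only [LinearMap.comp_apply, LinearMap.smul_apply, Module.Basis.coord_apply,
      Module.Basis.repr_self]
    rw [monoBasis_apply, hd', monoBasis_repr_mono, Finsupp.single_apply, Finsupp.single_apply]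
    by_cases hr : r = p
    · subst hr
      rw [hd] at hd'
      have := congrArg (fun z => (monoBasis q).repr z (τ r)) hd'
      simp only [monoBasis_repr_mono] at this
      simpa using this.symm
    · simp [hr, hτ.ne hr]
  exact LinearMap.congr_fun key a

theorem exists_repr_ne_zero (h : IsMonomialMap L τ) {a : QTorus q} {w : ℤ × ℤ}
    (hw : (monoBasis q).repr (L a) w ≠ 0) : ∃ p, (monoBasis q).repr a p ≠ 0 ∧ τ p = w := by
  by_contra! hcon
  apply hw
  have ha := (monoBasis q).linearCombination_repr a
  rw [← ha, Finsupp.linearCombination_apply, map_finsuppSum, map_finsuppSum, Finsupp.sum,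
    Finsupp.finsetSum_apply]
  refine Finset.sum_eq_zero fun p hp => ?_
  obtain ⟨d, hd⟩ := h 1 p
  rw [map_smul, monoBasis_apply, hd, map_smul, monoBasis_repr_mono, Finsupp.smul_apply,
    Finsupp.single_eq_of_ne, smul_zero]
  exact (hcon p (Finsupp.mem_support_iff.1 hp)).symm

end IsMonomialMap

end QTorus

/-! ### Irrationality of the eigenvalue. -/

/-- The equation makes each of `a`, `b` divide the square of the other; by coprimality both are
units. -/
theorem Int.eq_one_or_neg_one_of_sq_sub_mul_add_sq {a b t : ℤ} (hab : IsCoprime a b)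
    (h : a ^ 2 - t * a * b + b ^ 2 = 0) : a = b ∨ a = -b := by
  have ha : IsUnit a := by
    have : IsCoprime a (b ^ 2) := hab.pow_right
    exact this.isUnit_of_dvd' dvd_rfl ⟨t * b - a, by linarith⟩
  have hb : IsUnit b := by
    have : IsCoprime b (a ^ 2) := hab.symm.pow_right
    exact this.isUnit_of_dvd' dvd_rfl ⟨t * a - b, by linarith⟩
  rcases Int.isUnit_iff.1 ha with rfl | rfl <;> rcases Int.isUnit_iff.1 hb with rfl | rfl <;> simp

/-- Rational root theorem: clearing denominators in lowest terms gives the homogeneous equation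
above, which leaves only ±1. -/
theorem irrational_of_sq_sub_mul_add_one {r : ℝ} {t : ℤ} (h : r ^ 2 - t * r + 1 = 0)
    (h1 : r ≠ 1) (h2 : r ≠ -1) : Irrational r := by
  rintro ⟨z, rfl⟩
  have hd : (z.den : ℚ) ≠ 0 := by exact_mod_cast z.den_ne_zero
  have hz : z ^ 2 - t * z + 1 = 0 := by exact_mod_cast h
  have hnd : (z.num : ℚ) = z * z.den := (Rat.mul_den_eq_num z).symm
  have hZ : (z.num : ℚ) ^ 2 - t * z.num * z.den + (z.den : ℚ) ^ 2 = 0 := by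
    rw [hnd]
    linear_combination (z.den : ℚ) ^ 2 * hz
  have hZ' : z.num ^ 2 - t * z.num * (z.den : ℤ) + (z.den : ℤ) ^ 2 = 0 := by exact_mod_cast hZ
  have hcop : IsCoprime z.num (z.den : ℤ) := Int.isCoprime_iff_nat_coprime.2 (by
    simpa using z.reduced)
  rcases Int.eq_one_or_neg_one_of_sq_sub_mul_add_sq hcop hZ' with h' | h'
  · refine h1 ?_
    rw [h'] at hnd
    push_cast at hnd
    have : z = 1 := mul_right_cancel₀ hd (by linarith)
    simp [this]
  · refine h2 ?_
    rw [h'] at hnd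
    push_cast at hnd
    have : z = -1 := mul_right_cancel₀ hd (by linarith)
    simp [this]

/-! ### The degree functional and the vanishing of skew derivations. -/

namespace QTorus

/-- The action of `σ` on the degrees of monomials. -/
def degreeMap (σ : SL(2, ℤ)) (p : ℤ × ℤ) : ℤ × ℤ :=
  (p.1 * σ 0 0 + p.2 * σ 0 1, p.1 * σ 1 0 + p.2 * σ 1 1)

/-- Pairing with a left r-eigenvector of `σ` scales by `r`. Its kernel on ℤ² is trivial because `r`
is irrational. -/
theorem exists_degree_functional (σ : SL(2, ℤ)) {r : ℝ}
    (h : r ^ 2 - (σ 0 0 + σ 1 1 : ℤ) * r + 1 = 0) (h1 : r ≠ 1) (h2 : r ≠ -1) :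
    ∃ ℓ : ℤ × ℤ →+ ℝ, (∀ p, ℓ p = 0 → p = 0) ∧ ∀ p, ℓ (degreeMap σ p) = r * ℓ p := by
  have hirr := irrational_of_sq_sub_mul_add_one h h1 h2
  have hdet : (σ 0 0 * σ 1 1 - σ 0 1 * σ 1 0 : ℝ) = 1 := by
    have := σ.det_coe
    rw [Matrix.det_fin_two] at this
    exact_mod_cast this
  push_cast at h
  -- The row vector (m, r - k) satisfies (m, r - k)σ = r(m, r - k), by the characteristic equation.
  refine ⟨{ toFun := fun p => σ 1 0 * p.1 + (r - σ 0 0) * p.2, map_zero' := by simp,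
            map_add' := fun p p' => by simp; ring }, fun p hp => ?_, fun p => ?_⟩
  · change (σ 1 0 * p.1 + (r - σ 0 0) * p.2 : ℝ) = 0 at hp
    have hp2 : p.2 = 0 := by
      by_contra hne
      have hne' : (p.2 : ℝ) ≠ 0 := by exact_mod_cast hne
      refine hirr ⟨σ 0 0 - σ 1 0 * p.1 / p.2, ?_⟩
      push_cast
      field_simp
      linarith
    -- A triangular `σ` would have its integer diagonal entries as eigenvalues.
    have hm : σ 1 0 ≠ 0 := by
      intro hm
      rw [hm] at hdet
      have : (r - σ 0 0) * (r - σ 1 1) = 0 := by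
        push_cast at hdet
        linear_combination h + hdet
      rcases mul_eq_zero.1 this with h' | h'
      · exact hirr.ne_int (σ 0 0) (sub_eq_zero.1 h')
      · exact hirr.ne_int (σ 1 1) (sub_eq_zero.1 h')
    rw [hp2] at hp
    have : σ 1 0 * p.1 = 0 := by
      push_cast at hp
      have : (σ 1 0 : ℝ) * p.1 = 0 := by linarith
      exact_mod_cast this
    exact Prod.ext ((mul_eq_zero.1 this).resolve_left hm) hp2
  · change (σ 1 0 * ((p.1 * σ 0 0 + p.2 * σ 0 1 : ℤ) : ℝ)
      + (r - σ 0 0) * ((p.1 * σ 1 0 + p.2 * σ 1 1 : ℤ) : ℝ))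
      = r * (σ 1 0 * p.1 + (r - σ 0 0) * p.2)
    push_cast
    linear_combination (-(p.2 : ℝ)) * h - (p.2 : ℝ) * hdet

variable {q : ℂˣ}

theorem isMonomialMap_phi (σ : SL(2, ℤ)) (α β : ℂˣ) :
    IsMonomialMap (phi q σ α β).toLinearMap (degreeMap σ) :=
  fun c p => phiHom_mono q σ α β c p.1 p.2

/-- Covers the two-sided multiplications M⁻¹(·)φ(M) and N⁻¹(·)φ(N), which translate degrees. -/
theorem isMonomialMap_mulLeftRight (c d : ℂˣ) (v w : ℤ × ℤ) :
    IsMonomialMap (LinearMap.mulLeftRight ℂ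
      ((mono q c v.1 v.2 : QTorus q), (mono q d w.1 w.2 : QTorus q))) (fun p => v + p + w) := by
  intro b p
  refine ⟨c * b * q ^ (p.1 * v.2) * d * q ^ (w.1 * (v.2 + p.2)), ?_⟩
  rw [LinearMap.mulLeftRight_apply, ← Units.val_mul, ← Units.val_mul, mono_mul, mono_mul]
  rfl

/-- Comparing the terms of least degree in `c (P u - R u) = u - T u`. -/
theorem eq_zero_of_smul_sub_eq_sub {P R T : QTorus q →ₗ[ℂ] QTorus q} {τ ρ θ : ℤ × ℤ → ℤ × ℤ}
    (hP : IsMonomialMap P τ) (hR : IsMonomialMap R ρ) (hT : IsMonomialMap T θ)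
    {ℓ : ℤ × ℤ →+ ℝ} (hℓ : ∀ p, ℓ p = 0 → p = 0) {κ δ ε : ℝ} (hκ : 0 < κ) (hκ1 : κ ≠ 1)
    (hδ : 0 < δ) (hε : 0 < ε) (hτ : ∀ p, ℓ (τ p) = κ * ℓ p) (hρ : ∀ p, ℓ (ρ p) = κ * ℓ p + δ)
    (hθ : ∀ p, ℓ (θ p) = ℓ p + ε) (hP1 : P 1 = 1) {c : ℂ} (hc : c ≠ 0) (hc1 : c ≠ 1)
    {u : QTorus q} (h : c • (P u - R u) = u - T u) : u = 0 := by
  by_contra hu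
  have hτinj : Function.Injective τ := fun p p' hpp => by
    have h1 := congrArg ℓ hpp
    rw [hτ, hτ] at h1
    exact sub_eq_zero.1 (hℓ _ (by rw [map_sub, mul_left_cancel₀ hκ.ne' h1, sub_self]))
  have hsupp : ((monoBasis q).repr u).support.Nonempty :=
    Finsupp.support_nonempty_iff.2 (by simpa using hu)
  obtain ⟨p, hp, hmin⟩ := Finset.exists_min_image _ ℓ hsupp
  rw [Finsupp.mem_support_iff] at hp
  have hU : ∀ w, ℓ w < ℓ p → (monoBasis q).repr u w = 0 := fun w hw => by
    by_contra hne
    exact absurd (hmin w (Finsupp.mem_support_iff.2 hne)) hw.not_ge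
  have hPu : ∀ w, ℓ w < κ * ℓ p → (monoBasis q).repr (P u) w = 0 := fun w hw => by
    by_contra hne
    obtain ⟨r, hr, rfl⟩ := hP.exists_repr_ne_zero hne
    rw [hτ] at hw
    exact hr (hU r (lt_of_mul_lt_mul_left hw hκ.le))
  have hRu : ∀ w, ℓ w < κ * ℓ p + δ → (monoBasis q).repr (R u) w = 0 := fun w hw => by
    by_contra hne
    obtain ⟨r, hr, rfl⟩ := hR.exists_repr_ne_zero hne
    rw [hρ] at hw
    exact hr (hU r (lt_of_mul_lt_mul_left (lt_of_add_lt_add_right hw) hκ.le))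
  have hTu : ∀ w, ℓ w < ℓ p + ε → (monoBasis q).repr (T u) w = 0 := fun w hw => by
    by_contra hne
    obtain ⟨r, hr, rfl⟩ := hT.exists_repr_ne_zero hne
    rw [hθ] at hw
    exact hr (hU r (lt_of_add_lt_add_right hw))
  have hcoef : ∀ w, c * ((monoBasis q).repr (P u) w - (monoBasis q).repr (R u) w)
      = (monoBasis q).repr u w - (monoBasis q).repr (T u) w := fun w => by
    have := congrArg (fun z => (monoBasis q).repr z w) h
    simpa using this
  obtain ⟨s, hs, hsP⟩ := hP.exists_repr_apply hτinj p
  -- The left side starts at level κℓ(p), from `P u`, and the right side at ℓ(p), from `u`; `R u`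
  -- and `T u` lie strictly above these. If the two levels differ, the lower one has an uncancelled
  -- coefficient.
  rcases lt_trichotomy (κ * ℓ p) (ℓ p) with hlt | heq | hgt
  · have := hcoef (τ p)
    rw [hsP, hRu (τ p) (by rw [hτ]; linarith), hU (τ p) (by rw [hτ]; linarith),
      hTu (τ p) (by rw [hτ]; linarith), sub_zero, sub_zero] at this
    exact mul_ne_zero hc (mul_ne_zero hs hp) this
  -- Equal levels force `p = 0`. Since `P 1 = 1`, `P` preserves the constant coefficient, so the
  -- equation reduces to c = 1.
  · have hp0 : p = 0 := hℓ p (by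
      have : (κ - 1) * ℓ p = 0 := by linarith
      exact (mul_eq_zero.1 this).resolve_left (sub_ne_zero.2 hκ1))
    subst hp0
    have hτ0 : τ 0 = 0 := hℓ _ (by rw [hτ, map_zero, mul_zero])
    have hone : (monoBasis q).repr (1 : QTorus q) 0 = 1 := by
      have := monoBasis_repr_mono q 1 0 0
      rw [mono_one] at this
      rw [← Units.val_one, this]
      exact Finsupp.single_eq_same
    have hs1 : s = 1 := by
      have := hsP 1
      rwa [hP1, hτ0, hone, mul_one, eq_comm] at this
    have := hcoef 0
    have hP0 := hsP u
    rw [hτ0, hs1, one_mul] at hP0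
    rw [hP0, hRu 0 (by linarith), hTu 0 (by linarith), sub_zero] at this
    exact hc1 (mul_right_cancel₀ hp (by rw [this, one_mul]))
  · have := hcoef p
    rw [hPu p hgt, hRu p (by linarith), hTu p (by linarith), sub_zero, mul_zero, sub_zero] at this
    exact hp this.symm

/-- A skew derivation `D` with `D(ab) = a D(b) + D(a) φ(b)` and `φ D = q² D φ`, where `φ` is the
automorphism attached to `σ` with a real eigenvalue other than `±1`, vanishes. -/
theorem skewDerivation_eq_zero (hq : ∀ n : ℤ, n ≠ 0 → q ^ n ≠ 1) (σ : SL(2, ℤ)) (α β : ℂˣ)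
    {r : ℝ} (h : r ^ 2 - (σ 0 0 + σ 1 1 : ℤ) * r + 1 = 0) (h1 : r ≠ 1) (h2 : r ≠ -1)
    (D : QTorus q →ₗ[ℂ] QTorus q) (hmul : ∀ a b, D (a * b) = a * D b + D a * phi q σ α β b)
    (hD : ∀ a, phi q σ α β (D a) = (q : ℂ) ^ 2 • D (phi q σ α β a)) : D = 0 := by
  obtain ⟨ℓ₀, hℓ₀, hσ₀⟩ := exists_degree_functional σ h h1 h2
  have hr0 : r ≠ 0 := by rintro rfl; simp at h
  refine (monoBasis q).ext fun v => ?_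
  rw [monoBasis_apply, LinearMap.zero_apply]
  -- Degree 0 is separate, since the shift (r - 1)ℓ(v) would vanish; there D(1) = D(1) + D(1).
  by_cases hv : v = 0
  · have h11 := hmul 1 1
    rw [map_one (phi q σ α β), mul_one, mul_one, one_mul, left_eq_add] at h11
    subst hv
    change D (mono q 1 0 0 : QTorus q) = 0
    rw [mono_one, Units.val_one, h11]
  -- Replacing ℓ by -ℓ if necessary makes the shift positive.
  obtain ⟨ℓ, hℓ, hσ, hpos⟩ : ∃ ℓ : ℤ × ℤ →+ ℝ, (∀ p, ℓ p = 0 → p = 0) ∧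
      (∀ p, ℓ (degreeMap σ p) = r * ℓ p) ∧ 0 < (r - 1) * ℓ v := by
    have hne : (r - 1) * ℓ₀ v ≠ 0 := mul_ne_zero (sub_ne_zero.2 h1) fun h0 => hv (hℓ₀ v h0)
    rcases hne.lt_or_gt with hlt | hgt
    · refine ⟨-ℓ₀, fun p hp => hℓ₀ p (by simpa using hp), fun p => ?_, ?_⟩
      · rw [AddMonoidHom.neg_apply, AddMonoidHom.neg_apply, hσ₀, mul_neg]
      · rw [AddMonoidHom.neg_apply]; linarith
    · exact ⟨ℓ₀, hℓ₀, hσ₀, hgt⟩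
  set φ := phi q σ α β with hφ
  have hφm := isMonomialMap_phi (q := q) σ α β
  rw [← hφ] at hφm
  -- Below, `K`, `N`, `K'` are φ(M), φ²(M), φ³(M); thus `K' = φ(N)`.
  obtain ⟨c₁, hc₁⟩ := hφm 1 v
  obtain ⟨c₂, hc₂⟩ := hφm c₁ (degreeMap σ v)
  obtain ⟨c₃, hc₃⟩ := hφm c₂ (degreeMap σ (degreeMap σ v))
  simp only [AlgEquiv.toLinearMap_apply] at hc₁ hc₂ hc₃
  set M := mono q 1 v.1 v.2 with hM
  set K := mono q c₁ (degreeMap σ v).1 (degreeMap σ v).2 with hK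
  set N := mono q c₂ (degreeMap σ (degreeMap σ v)).1 (degreeMap σ (degreeMap σ v)).2 with hN
  set K' := mono q c₃ (degreeMap σ (degreeMap σ (degreeMap σ v))).1
    (degreeMap σ (degreeMap σ (degreeMap σ v))).2 with hK'
  obtain ⟨m, hm⟩ := mono_inv q 1 v.1 v.2
  obtain ⟨n, hn⟩ := mono_inv q c₂ (degreeMap σ (degreeMap σ v)).1 (degreeMap σ (degreeMap σ v)).2
  obtain ⟨s, hs⟩ : ∃ s : ℂ, (M * N : QTorus q) = s • (N * M : QTorus q) := by
    rw [← Units.val_mul, ← Units.val_mul, hM, hN, mono_mul, mono_mul, coe_mono,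
      coe_mono (c := c₂ * 1 * _), add_comm v.1, add_comm v.2]
    refine ⟨(1 * c₂ * q ^ ((degreeMap σ (degreeMap σ v)).1 * v.2) : ℂˣ) /
      (c₂ * 1 * q ^ (v.1 * (degreeMap σ (degreeMap σ v)).2) : ℂˣ), ?_⟩
    rw [smul_smul, div_mul_cancel₀ _ (Units.ne_zero _)]
  have hq2 : (q : ℂ) ^ 2 ≠ 0 := pow_ne_zero _ q.ne_zero
  have hq4 : (q : ℂ) ^ 4 ≠ 0 := pow_ne_zero _ q.ne_zero
  have hDφ : ∀ a, D (φ a) = ((q : ℂ) ^ 2)⁻¹ • φ (D a) := fun a => by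
    rw [hD, inv_smul_smul₀ hq2]
  obtain ⟨u, hDM⟩ : ∃ u, D M = M * u :=
    ⟨(M⁻¹ : (QTorus q)ˣ) * D M, (Units.mul_inv_cancel_left _ _).symm⟩
  have hDN : D N = ((q : ℂ) ^ 4)⁻¹ • (N * φ (φ u)) := by
    rw [← hc₂, ← hc₁, hDφ, hDφ, hDM, map_smul, map_mul, map_mul, smul_smul, hc₁, ← mul_inv,
      ← pow_add]
  -- Apply D to MN = sNM, use the same relation to turn every sNM into MN, and cancel the unit MN.
  have hcocycle : ((q : ℂ) ^ 4)⁻¹ • (φ (φ u) - (M⁻¹ : (QTorus q)ˣ) * φ (φ u) * K)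
      = u - (N⁻¹ : (QTorus q)ˣ) * u * K' := by
    have e1 : D (M * N : QTorus q) = s • D (N * M : QTorus q) := by rw [hs, map_smul]
    rw [hmul, hmul, hDM, hDN, hc₁, hc₃] at e1
    have e2 : (s • (N * (M * u)) : QTorus q) = M * N * u := by
      rw [hs, smul_mul_assoc, mul_assoc]
    have e3 : s • (N * φ (φ u) * K : QTorus q) = M * N * ((M⁻¹ : (QTorus q)ˣ) * φ (φ u) * K) := by
      rw [hs, smul_mul_assoc, mul_assoc (N : QTorus q) M, mul_assoc (M⁻¹ : (QTorus q)ˣ).val,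
        Units.mul_inv_cancel_left, mul_assoc]
    have e4 : (M * u * K' : QTorus q) = M * N * ((N⁻¹ : (QTorus q)ˣ) * u * K') := by
      rw [mul_assoc (M : QTorus q) N, mul_assoc (N⁻¹ : (QTorus q)ˣ).val,
        Units.mul_inv_cancel_left, mul_assoc]
    rw [smul_add, e2, smul_mul_assoc, smul_comm s, e3, e4, mul_smul_comm, ← mul_assoc (M : QTorus q),
      ← mul_smul_comm, ← mul_smul_comm, ← mul_add, ← mul_add, ← Units.val_mul,
      Units.mul_right_inj] at e1
    rw [smul_sub, sub_eq_sub_iff_add_eq_add, e1]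
  have hP := hφm.comp hφm
  -- `R` translates by σv - v after σ², and `T` translates by σ³v - σ²v; under ℓ these are (r -
  -- 1)ℓ(v) and r²(r - 1)ℓ(v).
  have hR := (isMonomialMap_mulLeftRight (q := q) m c₁ (-v) (degreeMap σ v)).comp hP
  have hT := isMonomialMap_mulLeftRight (q := q) n c₃ (-degreeMap σ (degreeMap σ v))
    (degreeMap σ (degreeMap σ (degreeMap σ v)))
  have hκ : r ^ 2 ≠ 1 := fun h' => (sq_eq_sq_iff_eq_or_eq_neg.1 (h'.trans (one_pow 2).symm)).elim h1 h2
  have hu0 : u = 0 := by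
    refine eq_zero_of_smul_sub_eq_sub hP hR hT hℓ (κ := r ^ 2) (δ := (r - 1) * ℓ v)
      (ε := r ^ 2 * ((r - 1) * ℓ v)) (by positivity) hκ hpos (by positivity) (fun p => ?_)
      (fun p => ?_) (fun p => ?_) ?_ (inv_ne_zero hq4) (fun h' => ?_) (u := u) ?_
    · simp only [Function.comp_apply, hσ]; ring
    · simp only [Function.comp_apply, map_add, map_neg, hσ]; ring
    · simp only [map_add, map_neg, hσ]; ring
    · simp
    · refine hq 4 (by norm_num) (Units.ext ?_)
      rw [inv_eq_one] at h'
      have h4 : ((q ^ (4 : ℕ) : ℂˣ) : ℂ) = 1 := by rw [Units.val_pow_eq_pow_val, h']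
      exact h4
    · rw [hm, hn] at hcocycle
      exact hcocycle
  rw [hDM, hu0, mul_zero]

end QTorus

/-! ### Conclusion for symmetries. -/

theorem IsModuleAlgebra.e_mul {A : Type*} [Ring A] [Algebra ℂ A] {q : ℂˣ}
    {π : Uq q →ₐ[ℂ] Module.End ℂ A} (h : IsModuleAlgebra π) (a b : A) :
    π (Uq.e q) (a * b) = a * π (Uq.e q) b + π (Uq.e q) a * π (Uq.k q) b := by
  rw [h.map_mul, Uq.comul_eq, Uq.comulHom, Uq.lift_e]
  simp

theorem proposition3p4 (q : ℂˣ) (hq : ∀ n : ℤ, n ≠ 0 → q ^ n ≠ 1)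
    (σ : SL(2, ℤ)) (α β : ℂˣ) (lam mu : ℝ)
    (heig : (σ.1.map (Int.cast : ℤ → ℝ)).charpoly.roots = {lam, mu})
    (hlam : lam ≠ 1 ∧ lam ≠ -1) (hmu : mu ≠ 1 ∧ mu ≠ -1) :
    ¬ ∃ π : Uq q →ₐ[ℂ] Module.End ℂ (QTorus q),
      IsModuleAlgebra π ∧ π (Uq.k q) = (QTorus.phi q σ α β).toLinearMap := by
  rintro ⟨π, hπ, hk⟩
  have hroot : lam ^ 2 - (σ 0 0 + σ 1 1 : ℤ) * lam + 1 = 0 := by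
    have hmem : lam ∈ (σ.1.map (Int.cast : ℤ → ℝ)).charpoly.roots := by rw [heig]; simp
    have h := Polynomial.isRoot_of_mem_roots hmem
    have hdet : (σ 0 0 * σ 1 1 - σ 0 1 * σ 1 0 : ℝ) = 1 := by
      have := σ.det_coe
      rw [Matrix.det_fin_two] at this
      exact_mod_cast this
    rw [Polynomial.IsRoot, Matrix.charpoly_fin_two, Matrix.trace_fin_two, Matrix.det_fin_two] at h
    simp at h
    push_cast
    linear_combination h - hdet
  have hk' : ∀ a, π (Uq.k q) a = QTorus.phi q σ α β a := fun a => by rw [hk]; rfl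
  have he : π (Uq.e q) = 0 := by
    refine QTorus.skewDerivation_eq_zero hq σ α β hroot hlam.1 hlam.2 _ (fun a b => ?_) fun a => ?_
    · rw [hπ.e_mul, hk']
    · have := LinearMap.congr_fun (congrArg π (Uq.k_mul_e q)) a
      rw [map_smul, map_mul, map_mul] at this
      simpa [hk'] using this
  have hqq : ((q : ℂ) - (q : ℂ)⁻¹)⁻¹ ≠ 0 := by
    refine inv_ne_zero (sub_ne_zero.2 fun h => hq 2 (by norm_num) (Units.ext ?_))
    have : (q : ℂ) * q = 1 := by
      nth_rewrite 2 [h]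
      exact mul_inv_cancel₀ q.ne_zero
    simpa [zpow_ofNat, pow_two] using this
  -- With `e` acting by zero the commutator of `e` and `f` acts by zero, and q ≠ q⁻¹.
  have hkk : π (Uq.k q) = π (Uq.kInv q) := by
    have := congrArg π (Uq.e_f_sub q)
    rw [map_sub, map_mul, map_mul, he, zero_mul, mul_zero, sub_zero, map_smul, map_sub] at this
    exact sub_eq_zero.1 ((smul_eq_zero.1 this.symm).resolve_left hqq)
  have hsq : ∀ a, QTorus.phi q σ α β (QTorus.phi q σ α β a) = a := fun a => by
    have := LinearMap.congr_fun (congrArg π (Uq.kInv_mul_k q)) a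
    rw [map_mul, ← hkk, map_one] at this
    simpa [hk'] using this
  obtain ⟨ℓ, hℓ, hσ⟩ := QTorus.exists_degree_functional σ hroot hlam.1 hlam.2
  have hφ := QTorus.isMonomialMap_phi (q := q) σ α β
  obtain ⟨d, hd⟩ := (hφ.comp hφ) 1 (1, 0)
  have hd' : (QTorus.mono q 1 1 0 : QTorus q) = _ := (hsq _).symm.trans hd
  have hrepr := congrArg (QTorus.monoBasis q).repr hd'
  rw [QTorus.monoBasis_repr_mono, QTorus.monoBasis_repr_mono] at hrepr
  -- φ² fixes x, so comparing basis expansions shows that σ² fixes its degree.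
  have hdeg : ((1, 0) : ℤ × ℤ) = QTorus.degreeMap σ (QTorus.degreeMap σ (1, 0)) := by
    rcases (Finsupp.single_eq_single_iff _ _ _ _).1 hrepr with h | h
    · exact h.1
    · exact absurd h.1 one_ne_zero
  have hℓ1 : (lam ^ 2 - 1) * ℓ (1, 0) = 0 := by
    have := congrArg ℓ hdeg
    rw [hσ, hσ] at this
    linarith
  rcases mul_eq_zero.1 hℓ1 with h | h
  · exact (sq_eq_sq_iff_eq_or_eq_neg.1 ((sub_eq_zero.1 h).trans (one_pow 2).symm)).elim
      hlam.1 hlam.2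
  · exact absurd (congrArg Prod.fst (hℓ _ h)) one_ne_zero
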